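/- Let $G$ be a finite undirected graph with at most one edge per pair of vertices, regarded as reflexive (every vertex has a loop). A walk from $s$ to $t$ is a finite sequence of vertices that starts at $s$, ends at $t$ and whose consecutive vertices are adjacent or equal; a shortest path from $s$ to $t$ is such a walk with the least number of vertices. Chain pursuit with delay time $\Delta$ is the following process. The agent $A_0$ takes an arbitrary walk from $s$ to $t$, one step per unit of time, and stays at $t$ afterwards. For $i\ge 1$ the agent $A_i$ leaves $s$ exactly $\Delta$ time units after $A_{i-1}$. In each time unit it chooses, uniformly at random and independently of earlier choices, a shortest path in $G$ from its current vertex to the current vertex of $A_{i-1}$ and moves to the next vertex of that path (it stays in place if both are at the same vertex). It stops as soon as $A_{i-1}$ has completed its walk and $A_i$ is itself at $t$. Let $P(A_i)$ be the walk of $A_i$. The Markov chain $\mathcal M_\Delta(s,t)$ has as states all walks from $s$ to $t$ and as transition probabilities $\mathrm{Prob}[P(A_{i+1})=Q \mid P(A_i)=P]$. A closed class of a Markov chain is a nonempty set of states any two of which can be reached from each other with positive probability in finitely many steps, and from which no state outside the set can be so reached. The graph $G$ is stable if $\mathcal M_\Delta(s,t)$ has exactly one closed class for all vertices $s,t$ and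 all integers $\Delta>1$. Proposition. Let $G$ be a stable graph. Then for every integer $\Delta>1$ and all vertices $s,t$ of $G$, the limiting distribution of $\mathcal M_\Delta(s,t)$ is the uniform distribution over all shortest paths from $s$ to $t$. That is, shortest paths from $s$ to $t$ exist, and, whatever the law of $P(A_0)$, for every walk $Q$ from $s$ to $t$ the probability $\mathrm{Prob}[P(A_n)=Q]$ converges, as $n\to\infty$, to $1/N$ if $Q$ is a shortest path from $s$ to $t$ and to $0$ otherwise, where $N$ is the number of shortest paths from $s$ to $t$. -/

import Mathlib

/-! ### Markov chains on a discrete state space -/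

namespace MarkovChain

/-- The law after `n` steps of the chain with transition kernel `K` and initial law `μ`. -/
noncomputable def law {α : Type*} (K : α → PMF α) (μ : PMF α) : ℕ → PMF α
  | 0 => μ
  | n + 1 => (law K μ n).bind K

/-- `y` can be reached from `x` with positive probability in a finite number of steps. -/
def LeadsTo {α : Type*} (K : α → PMF α) : α → α → Prop :=
  Relation.ReflTransGen fun x y => y ∈ (K x).support

/-- A closed communicating class: a nonempty set of states that all communicate with each other,
and from which no state outside the set can be reached. -/
def IsClosedClass {α : Type*} (K : α → PMF α) (C : Set α) : Prop :=
  C.Nonempty ∧ (∀ x ∈ C, ∀ y ∈ C, LeadsTo K x y) ∧ ∀ x ∈ C, ∀ y, LeadsTo K x y → y ∈ C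

/-- `π` is the limiting distribution of the chain: whatever the initial law, the probability of
being in state `y` after `n` steps tends to `π y`. -/
def IsLimitingDistribution {α : Type*} (K : α → PMF α) (π : PMF α) : Prop :=
  ∀ (μ : PMF α) (y : α), Filter.Tendsto (fun n => law K μ n y) Filter.atTop (nhds (π y))

end MarkovChain

/-! ### Walks in the reflexive graph and chain pursuit -/

namespace ChainPursuit

variable {V : Type*}

/-- The list of vertices `l` is a walk from `s` to `t` in the reflexive closure of `G`: each two
consecutive vertices are adjacent or equal. -/
def IsWalk (G : SimpleGraph V) (s t : V) (l : List V) : Prop :=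
  l.IsChain (fun u v => u = v ∨ G.Adj u v) ∧ l.head? = some s ∧ l.getLast? = some t

/-- The walks from `s` to `t`. -/
abbrev Walk (G : SimpleGraph V) (s t : V) : Type _ := {l : List V // IsWalk G s t l}

/-- The number of vertices that a walk traverses. -/
def Walk.len {G : SimpleGraph V} {s t : V} (p : Walk G s t) : ℕ := p.1.length

theorem finite_setOf_shortest [Finite V] (G : SimpleGraph V) (s t : V) :
    {p : Walk G s t | ∀ q : Walk G s t, p.len ≤ q.len}.Finite := by
  rcases isEmpty_or_nonempty (Walk G s t) with h | ⟨⟨q⟩⟩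
  · exact Set.toFinite _
  · refine Set.Finite.subset (Set.Finite.preimage (f := Subtype.val) (Set.injOn_of_injective
      Subtype.val_injective) (List.finite_length_le V q.len)) ?_
    intro p hp
    exact hp q

/-- The shortest paths from `s` to `t`, i.e. the walks from `s` to `t` of least length. -/
noncomputable def shortestPaths [Finite V] (G : SimpleGraph V) (s t : V) :
    Finset (Walk G s t) :=
  (finite_setOf_shortest G s t).toFinset

theorem mem_shortestPaths [Finite V] {G : SimpleGraph V} {s t : V} {p : Walk G s t} :
    p ∈ shortestPaths G s t ↔ ∀ q : Walk G s t, p.len ≤ q.len := by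
  simp [shortestPaths]

theorem shortestPaths_nonempty [Finite V] {G : SimpleGraph V} {s t : V}
    (h : Nonempty (Walk G s t)) : (shortestPaths G s t).Nonempty := by
  obtain ⟨p, hp⟩ : ∃ p : Walk G s t, ∀ q : Walk G s t, p.len ≤ q.len :=
    ⟨Function.argmin Walk.len, fun q => Function.argmin_le Walk.len q⟩
  exact ⟨p, mem_shortestPaths.2 hp⟩

open Classical in
/-- One step of the pursuit rule, for an agent at `v` whose predecessor is at `u`: choose a
shortest path from `v` to `u` uniformly at random and move to its next vertex (and stay in place
if `v = u`). The value for `v` and `u` in different components is irrelevant. -/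
noncomputable def nextVertex [Finite V] (G : SimpleGraph V) (v u : V) : PMF V :=
  if h : Nonempty (Walk G v u) then
    (PMF.uniformOfFinset (shortestPaths G v u) (shortestPaths_nonempty h)).map
      fun p => p.1.getD 1 v
  else PMF.pure v

open Classical in
/-- The law of the list of vertices that an agent visits from its own time `k` on, if it is then at
`v`, and its predecessor, which started `Δ` time units earlier, takes the walk `P` and stays at its
end `t` afterwards. At its own time `k` the agent sees its predecessor at the vertex of `P` with
index `k + Δ`. The agent stops as soon as its predecessor has completed its walk and it is itself
at `t`. The first argument bounds the number of steps. -/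
noncomputable def pursue [Finite V] (G : SimpleGraph V) (Δ : ℕ) (t : V) (P : List V) :
    ℕ → ℕ → V → PMF (List V)
  | 0, _, v => PMF.pure [v]
  | N + 1, k, v =>
    if P.length ≤ k + Δ + 1 ∧ v = t then PMF.pure [v]
    else (nextVertex G v (P.getD (k + Δ) t)).bind fun w =>
      (pursue G Δ t P N (k + 1) w).map fun l => v :: l

theorem IsWalk.cons {G : SimpleGraph V} {v w t : V} {l : List V} (h : v = w ∨ G.Adj v w)
    (hl : IsWalk G w t l) : IsWalk G v t (v :: l) := by
  obtain ⟨h1, h2, h3⟩ := hl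
  cases l with
  | nil => simp at h2
  | cons a l =>
    simp only [List.head?_cons, Option.some.injEq] at h2
    subst h2
    exact ⟨List.isChain_cons_cons.2 ⟨h, h1⟩, rfl, by simpa [List.getLast?_cons_cons] using h3⟩

theorem isWalk_singleton (G : SimpleGraph V) (v : V) : IsWalk G v v [v] := by
  simp [IsWalk]

theorem IsWalk.snoc {G : SimpleGraph V} {v w t : V} {l : List V} (hl : IsWalk G v w l)
    (h : w = t ∨ G.Adj w t) : IsWalk G v t (l ++ [t]) := by
  obtain ⟨h1, h2, h3⟩ := hl
  refine ⟨?_, ?_, by simp⟩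
  · rw [List.isChain_append]
    refine ⟨h1, by simp, ?_⟩
    intro x hx y hy
    simp_all
  · simp [List.head?_append, h2]

/-- The next vertex `w` is a neighbour of `v` or `v` itself, and it is closer to `u` by one. -/
theorem nextVertex_spec [Finite V] {G : SimpleGraph V} {v u w : V} {l : List V}
    (hl : IsWalk G v u l) (hw : w ∈ (nextVertex G v u).support) :
    (v = w ∨ G.Adj v w) ∧
      ∃ l', IsWalk G w u l' ∧ (l'.length + 1 ≤ l.length ∨ l'.length ≤ 1) := by
  have hne : Nonempty (Walk G v u) := ⟨⟨l, hl⟩⟩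
  rw [nextVertex, dif_pos hne] at hw
  simp only [PMF.support_map, PMF.support_uniformOfFinset, Set.mem_image, Finset.mem_coe] at hw
  obtain ⟨⟨p, hp⟩, hmin, rfl⟩ := hw
  have hle : p.length ≤ l.length := mem_shortestPaths.1 hmin ⟨l, hl⟩
  obtain ⟨h1, h2, h3⟩ := hp
  match p, h1, h2, h3, hle with
  | [], _, h2, _, _ => simp at h2
  | [a], _, h2, h3, _ =>
    simp only [List.head?_cons, Option.some.injEq, List.getLast?_singleton] at h2 h3
    subst h2 h3
    exact ⟨Or.inl rfl, [a], isWalk_singleton G a, Or.inr le_rfl⟩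
  | a :: b :: q, h1, h2, h3, hle =>
    simp only [List.head?_cons, Option.some.injEq] at h2
    subst h2
    rw [List.isChain_cons_cons] at h1
    refine ⟨by simpa using h1.1, b :: q, ⟨h1.2, by simp, ?_⟩, Or.inl (by simpa using hle)⟩
    simpa [List.getLast?_cons_cons] using h3

theorem IsWalk.getD_step {G : SimpleGraph V} {s t : V} {P : List V} (hP : IsWalk G s t P) (j : ℕ) :
    P.getD j t = P.getD (j + 1) t ∨ G.Adj (P.getD j t) (P.getD (j + 1) t) := by
  obtain ⟨h1, -, h3⟩ := hP
  by_cases hj : j + 1 < P.length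
  · have := List.isChain_iff_getElem.1 h1 j hj
    simpa [List.getD_eq_getElem, hj, Nat.lt_of_succ_lt hj] using this
  · left
    rw [List.getD_eq_default _ _ (n := j + 1) (by omega)]
    by_cases hj' : j < P.length
    · rw [List.getLast?_eq_getElem?] at h3
      rw [List.getD_eq_getElem?_getD, show j = P.length - 1 by omega, h3]
      rfl
    · rw [List.getD_eq_default _ _ (by omega)]

theorem IsWalk.getD_of_le {G : SimpleGraph V} {s t : V} {P : List V} (hP : IsWalk G s t P) {j : ℕ}
    (hj : P.length ≤ j + 1) : P.getD j t = t := by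
  have := hP.2.2
  by_cases hj' : j < P.length
  · rw [List.getLast?_eq_getElem?] at this
    rw [List.getD_eq_getElem?_getD, show j = P.length - 1 by omega, this]
    rfl
  · rw [List.getD_eq_default _ _ (by omega)]

theorem IsWalk.exists_prefix {G : SimpleGraph V} {s t : V} {P : List V} (hP : IsWalk G s t P)
    (j : ℕ) : ∃ l, IsWalk G s (P.getD j t) l ∧ l.length ≤ j + 1 ∧ l.length ≤ P.length := by
  induction j with
  | zero =>
    have h2 := hP.2.1
    cases P with
    | nil => simp at h2
    | cons a q =>
      simp only [List.head?_cons, Option.some.injEq] at h2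
      subst h2
      exact ⟨[a], by simpa using isWalk_singleton G a, by simp, by simp⟩
  | succ j ih =>
    by_cases hj : j + 1 < P.length
    · obtain ⟨l, hl, h1, h2⟩ := ih
      exact ⟨_, hl.snoc (hP.getD_step j), by simpa using h1, by simp; omega⟩
    · refine ⟨P, ?_, by omega, le_rfl⟩
      rw [hP.getD_of_le (by omega)]
      exact hP

/-- A pursuit with at most as many steps as `P` has vertices ends at `t`. -/
theorem pursue_isWalk_aux [Finite V] {G : SimpleGraph V} {Δ : ℕ} {s t : V} {P : List V}
    (hP : IsWalk G s t P) (N : ℕ) : ∀ (k : ℕ) (v : V), k + N = P.length →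
      (∃ l, IsWalk G v (P.getD (k + Δ) t) l ∧ l.length ≤ max Δ 1 + 1 ∧ l.length ≤ N + 1) →
      ∀ Q ∈ (pursue G Δ t P N k v).support, IsWalk G v t Q := by
  induction N with
  | zero =>
    rintro k v hk ⟨l, hl, -, hlen⟩ Q hQ
    simp only [pursue, PMF.support_pure, Set.mem_singleton_iff] at hQ
    subst hQ
    rw [hP.getD_of_le (by omega)] at hl
    obtain ⟨h1, h2, h3⟩ := hl
    match l, h2, h3, hlen with
    | [], h2, _, _ => simp at h2
    | [a], h2, h3, _ =>
      simp only [List.head?_cons, Option.some.injEq, List.getLast?_singleton] at h2 h3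
      subst h2 h3
      exact isWalk_singleton G a
    | a :: b :: q, _, _, hlen => simp at hlen
  | succ N ih =>
    rintro k v hk ⟨l, hl, hlΔ, hlen⟩ Q hQ
    rw [pursue] at hQ
    split_ifs at hQ with harr
    · simp only [PMF.support_pure, Set.mem_singleton_iff] at hQ
      rw [hQ, harr.2]
      exact isWalk_singleton G t
    · simp only [PMF.mem_support_bind_iff, PMF.support_map, Set.mem_image] at hQ
      obtain ⟨w, hw, Q', hQ', rfl⟩ := hQ
      obtain ⟨hvw, l', hl', hlen'⟩ := nextVertex_spec hl hw
      refine IsWalk.cons hvw (ih (k + 1) w (by omega) ?_ Q' hQ')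
      by_cases hend : P.length ≤ k + Δ + 1
      · rw [hP.getD_of_le (by omega)] at hl'
        rw [hP.getD_of_le (by omega)]
        exact ⟨l', hl', by omega, by omega⟩
      · have := hl'.snoc (hP.getD_step (k + Δ))
        rw [show k + Δ + 1 = k + 1 + Δ by omega] at this
        exact ⟨_, this, by simp; omega, by simp; omega⟩

theorem pursue_isWalk [Finite V] {G : SimpleGraph V} {Δ : ℕ} {s t : V} {P : List V}
    (hP : IsWalk G s t P) {Q : List V} (hQ : Q ∈ (pursue G Δ t P P.length 0 s).support) :
    IsWalk G s t Q := by
  refine pursue_isWalk_aux hP P.length 0 s (by omega) ?_ Q hQ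
  obtain ⟨l, hl, h1, h2⟩ := hP.exists_prefix (0 + Δ)
  exact ⟨l, hl, by omega, by omega⟩

/-- The Markov chain of chain pursuit from `s` to `t` with delay time `Δ`, on the walks from `s`
to `t`: given that an agent takes the walk `P`, this is the law of the walk of the next agent. -/
noncomputable def pursuitChain [Finite V] (G : SimpleGraph V) (Δ : ℕ) (s t : V) :
    Walk G s t → PMF (Walk G s t) := fun P =>
  (pursue G Δ t P.1 P.len 0 s).bindOnSupport fun Q hQ => PMF.pure ⟨Q, pursue_isWalk P.2 hQ⟩

/-- `G` is `(s, t)`-stable with respect to the delay time `Δ`. -/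
def IsStableFor [Finite V] (G : SimpleGraph V) (Δ : ℕ) (s t : V) : Prop :=
  ∃! C : Set (Walk G s t), MarkovChain.IsClosedClass (pursuitChain G Δ s t) C

/-- `G` is stable. -/
def IsStable [Finite V] (G : SimpleGraph V) : Prop :=
  ∀ s t : V, ∀ Δ : ℕ, 1 < Δ → IsStableFor G Δ s t

end ChainPursuit

/-! The uniform law on shortest paths is stationary, and stability forces convergence to it.

Stationarity: let `P` be a uniform shortest path from `v` to `t`. The pursuer at `v` draws a uniform
shortest path to the vertex of `P` at index `Δ`. Splicing it into `P` gives a path `R` that is again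
uniform, and the pursuer takes the first step of `R`. Its later moves depend on `P` only beyond
index `Δ`, where `P` and `R` agree, so it goes on as if pursuing the rest of `R`. Given its first
step, that rest is a uniform shortest path, and induction on the length applies
(`pursue_eq_resample`, `geodesicLaw_bind_pursue`).

Convergence: walks never get longer (`length_le_of_mem_support_pursue`), so every state lies in a
finite closed set, and the shortest paths form one too. Hence the unique closed class consists of
shortest paths and is reachable from everywhere. A shortest path can reproduce itself
(`mem_support_pursue_self`), which rules out periodicity, and Doeblin's contraction argument
finishes (`isLimitingDistribution_of_unique`). -/

/-! ### Convergence of Markov chains to a stationary law. -/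

namespace MarkovChain

open Filter

variable {α : Type*} {K : α → PMF α}

theorem law_add (K : α → PMF α) (μ : PMF α) (m n : ℕ) :
    law K μ (n + m) = (law K μ m).bind fun z => law K (PMF.pure z) n := by
  induction n with
  | zero => simp [law]
  | succ n ih => rw [Nat.add_right_comm, law, ih, PMF.bind_bind]; rfl

theorem law_eq_bind (K : α → PMF α) (μ : PMF α) (n : ℕ) :
    law K μ n = μ.bind fun z => law K (PMF.pure z) n :=
  law_add K μ 0 n

theorem law_of_stationary {π : PMF α} (h : π.bind K = π) (n : ℕ) : law K π n = π := by
  induction n with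
  | zero => rfl
  | succ n ih => rw [law, ih, h]

theorem support_law_subset {F : Set α} (hF : ∀ x ∈ F, (K x).support ⊆ F) {μ : PMF α}
    (hμ : μ.support ⊆ F) (n : ℕ) : (law K μ n).support ⊆ F := by
  induction n with
  | zero => exact hμ
  | succ n ih =>
    intro y hy
    rw [law, PMF.mem_support_bind_iff] at hy
    obtain ⟨x, hx, hxy⟩ := hy
    exact hF x (ih hx) hxy

theorem LeadsTo.exists_mem_support_law {x y : α} (h : LeadsTo K x y) :
    ∃ n, y ∈ (law K (PMF.pure x) n).support := by
  induction h with
  | refl => exact ⟨0, by simp [law]⟩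
  | tail _ hyz ih =>
    obtain ⟨n, hn⟩ := ih
    exact ⟨n + 1, by rw [law, PMF.mem_support_bind_iff]; exact ⟨_, hn, hyz⟩⟩

theorem mem_support_law_of_le {x y : α} (hy : y ∈ (K y).support) {m n : ℕ} (hmn : m ≤ n)
    (h : y ∈ (law K (PMF.pure x) m).support) : y ∈ (law K (PMF.pure x) n).support := by
  induction n, hmn using Nat.le_induction with
  | base => exact h
  | succ n _ ih => rw [law, PMF.mem_support_bind_iff]; exact ⟨y, ih, hy⟩

theorem LeadsTo.mem_of_closed {F : Set α} (hF : ∀ x ∈ F, (K x).support ⊆ F) {x y : α}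
    (h : LeadsTo K x y) (hx : x ∈ F) : y ∈ F := by
  induction h with
  | refl => exact hx
  | tail _ hyz ih => exact hF _ ih hyz

/-- A state of a finite closed set leads to some closed class inside that set. -/
theorem exists_isClosedClass {F : Set α} (hfin : F.Finite) (hF : ∀ x ∈ F, (K x).support ⊆ F)
    {x : α} (hx : x ∈ F) : ∃ C, IsClosedClass K C ∧ C ⊆ F ∧ ∀ y ∈ C, LeadsTo K x y := by
  let R : α → Set α := fun z => {y | LeadsTo K z y}
  have hR : ∀ z ∈ F, R z ⊆ F := fun z hz y hy => LeadsTo.mem_of_closed hF hy hz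
  -- A state whose reachable set is smallest: any `y` reachable from `z` has a reachable set inside
  -- that of `z`, hence equal to it, so `y` leads back to `z`.
  obtain ⟨z, hz, hmin⟩ := Set.exists_min_image (R x) (fun z => (R z).ncard)
    (hfin.subset (hR x hx)) ⟨x, Relation.ReflTransGen.refl⟩
  have hzF := hR x hx hz
  have key : ∀ y ∈ R z, R y = R z := by
    intro y hy
    have hsub : R y ⊆ R z := fun w hw => Relation.ReflTransGen.trans hy hw
    exact Set.eq_of_subset_of_ncard_le hsub (hmin y (Relation.ReflTransGen.trans hz hy))
      (hfin.subset (hR z hzF))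
  refine ⟨R z, ⟨⟨z, Relation.ReflTransGen.refl⟩, ?_, ?_⟩, hR z hzF, ?_⟩
  · intro y hy w hw
    rw [← key y hy] at hw
    exact hw
  · intro y hy w hw
    exact Relation.ReflTransGen.trans hy hw
  · intro y hy
    exact Relation.ReflTransGen.trans hz hy

theorem sum_toReal_eq_one {F : Finset α} {p : PMF α} (hp : p.support ⊆ F) :
    ∑ z ∈ F, (p z).toReal = 1 := by
  rw [← ENNReal.toReal_sum fun z _ => p.apply_ne_top z, show ∑ z ∈ F, p z = 1 from ?_]
  · rfl
  · rw [← p.tsum_coe]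
    refine (tsum_eq_sum ?_).symm
    intro z hz
    by_contra h
    exact hz (hp ((p.mem_support_iff z).2 h))

theorem toReal_bind_apply {β : Type*} {F : Finset α} {p : PMF α} (hp : p.support ⊆ F)
    (f : α → PMF β) (y : β) :
    (p.bind f y).toReal = ∑ z ∈ F, (p z).toReal * (f z y).toReal := by
  rw [PMF.bind_apply, tsum_eq_sum (s := F), ENNReal.toReal_sum]
  · simp
  · intro z _
    exact ENNReal.mul_ne_top (p.apply_ne_top z) ((f z).apply_ne_top y)
  · intro z hz
    have : p z = 0 := by
      by_contra h
      exact hz (hp ((p.mem_support_iff z).2 h))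
    simp [this]

theorem average_le {F : Finset α} {p : PMF α} (hp : p.support ⊆ F) {h : α → ℝ} {b : ℝ}
    (hb : ∀ z ∈ F, h z ≤ b) {y : α} (hy : y ∈ F) {ε : ℝ} (hε : ε ≤ (p y).toReal) :
    ∑ z ∈ F, (p z).toReal * h z ≤ ε * h y + (1 - ε) * b := by
  have h1 : ∑ z ∈ F, (p z).toReal * (b - h z) = b - ∑ z ∈ F, (p z).toReal * h z := by
    simp only [mul_sub, Finset.sum_sub_distrib, ← Finset.sum_mul, sum_toReal_eq_one hp, one_mul]
  have h2 : (p y).toReal * (b - h y) ≤ ∑ z ∈ F, (p z).toReal * (b - h z) :=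
    Finset.single_le_sum (f := fun z => (p z).toReal * (b - h z))
      (fun z hz => mul_nonneg ENNReal.toReal_nonneg (sub_nonneg.2 (hb z hz))) hy
  have h3 := mul_le_mul_of_nonneg_right hε (sub_nonneg.2 (hb y hy))
  linarith

theorem le_average {F : Finset α} {p : PMF α} (hp : p.support ⊆ F) {h : α → ℝ} {a : ℝ}
    (ha : ∀ z ∈ F, a ≤ h z) {y : α} (hy : y ∈ F) {ε : ℝ} (hε : ε ≤ (p y).toReal) :
    ε * h y + (1 - ε) * a ≤ ∑ z ∈ F, (p z).toReal * h z := by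
  have := average_le hp (h := fun z => -h z) (b := -a) (fun z hz => neg_le_neg (ha z hz)) hy hε
  simp only [mul_neg, Finset.sum_neg_distrib] at this
  linarith

/-- A state with a loop that is reachable from all states of a finite set is hit from all of them
at one common time with probability bounded away from zero. -/
theorem exists_minorization {F : Finset α} {y₀ : α} (hloop : y₀ ∈ (K y₀).support)
    (hreach : ∀ x ∈ F, LeadsTo K x y₀) : ∃ m : ℕ, 0 < m ∧ ∃ ε : ℝ, 0 < ε ∧ ε ≤ 1 ∧
      ∀ x ∈ F, ε ≤ (law K (PMF.pure x) m y₀).toReal := by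
  choose! n hn using fun x hx => (hreach x hx).exists_mem_support_law
  refine ⟨F.sup n + 1, Nat.succ_pos _, ?_⟩
  have hpos : ∀ x ∈ F, 0 < (law K (PMF.pure x) (F.sup n + 1) y₀).toReal := fun x hx =>
    ENNReal.toReal_pos (mem_support_law_of_le hloop
      ((Finset.le_sup hx).trans (Nat.le_succ _)) (hn x hx)) (PMF.apply_ne_top _ _)
  rcases F.eq_empty_or_nonempty with rfl | hne
  · exact ⟨1, one_pos, le_rfl, by simp⟩
  · obtain ⟨x, hx, hmin⟩ := F.exists_min_image
      (fun x => (law K (PMF.pure x) (F.sup n + 1) y₀).toReal) hne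
    exact ⟨_, hpos x hx, ENNReal.toReal_le_of_le_ofReal zero_le_one (by simpa using PMF.coe_le_one _ _),
      hmin⟩

/-- Doeblin's argument: after `m` steps all starting points share mass `ε` at `y₀`, which
contributes the same amount to each probability. Only the remaining mass `1 - ε` can cause a
difference, so each block of `m` steps shrinks the spread by that factor. -/
theorem exists_contracting_interval {F : Finset α} (hF : ∀ x ∈ F, (K x).support ⊆ F) {y₀ : α}
    (hy₀ : y₀ ∈ F) {m : ℕ} {ε : ℝ}
    (hmin : ∀ x ∈ F, ε ≤ (law K (PMF.pure x) m y₀).toReal) (y : α) (r j : ℕ) :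
    ∃ a : ℝ, ∀ x ∈ F, a ≤ (law K (PMF.pure x) (r + m * j) y).toReal ∧
      (law K (PMF.pure x) (r + m * j) y).toReal ≤ a + (1 - ε) ^ j := by
  have hsupp : ∀ x ∈ F, (law K (PMF.pure x) m).support ⊆ F := fun x hx =>
    support_law_subset hF (by simpa using hx) m
  induction j with
  | zero =>
    exact ⟨0, fun x _ => ⟨ENNReal.toReal_nonneg, by
      simpa using ENNReal.toReal_le_of_le_ofReal zero_le_one (by simpa using PMF.coe_le_one _ _)⟩⟩
  | succ j ih =>
    obtain ⟨a, ha⟩ := ih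
    refine ⟨ε * (law K (PMF.pure y₀) (r + m * j) y).toReal + (1 - ε) * a, fun x hx => ?_⟩
    rw [Nat.mul_succ, ← add_assoc, law_add K _ m, toReal_bind_apply (hsupp x hx)]
    refine ⟨le_average (hsupp x hx) (fun z hz => (ha z hz).1) hy₀ (hmin x hx), ?_⟩
    refine (average_le (hsupp x hx) (fun z hz => (ha z hz).2) hy₀ (hmin x hx)).trans (le_of_eq ?_)
    ring

theorem tendsto_law_pure {F : Finset α} (hF : ∀ x ∈ F, (K x).support ⊆ F) {y₀ : α}
    (hy₀ : y₀ ∈ F) (hloop : y₀ ∈ (K y₀).support) (hreach : ∀ x ∈ F, LeadsTo K x y₀) {π : PMF α}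
    (hπ : π.bind K = π) (hπF : π.support ⊆ F) {x : α} (hx : x ∈ F) (y : α) :
    Tendsto (fun n => (law K (PMF.pure x) n y).toReal) atTop (nhds (π y).toReal) := by
  obtain ⟨m, hm, ε, hε, hε1, hmin⟩ := exists_minorization hloop hreach
  have hbound : ∀ n, |(law K (PMF.pure x) n y).toReal - (π y).toReal| ≤ (1 - ε) ^ (n / m) := by
    intro n
    obtain ⟨a, ha⟩ := exists_contracting_interval hF hy₀ hmin y (n % m) (n / m)
    rw [Nat.mod_add_div] at ha
    -- By stationarity `π y` is an average of the `n`-step probabilities, so it lies in the same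
    -- short interval. The bounds below use `ε = 0`, which makes `y₀` irrelevant.
    have hstat : (π y).toReal = ∑ z ∈ F, (π z).toReal * (law K (PMF.pure z) n y).toReal := by
      rw [← toReal_bind_apply hπF, ← law_eq_bind, law_of_stationary hπ]
    have h1 := average_le hπF (fun z hz => (ha z hz).2) hy₀ (ε := 0) ENNReal.toReal_nonneg
    have h2 := le_average hπF (fun z hz => (ha z hz).1) hy₀ (ε := 0) ENNReal.toReal_nonneg
    rw [← hstat] at h1 h2
    have := ha x hx
    rw [abs_le]
    constructor <;> linarith
  have hlim : Tendsto (fun n => (1 - ε) ^ (n / m)) atTop (nhds 0) :=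
    (tendsto_pow_atTop_nhds_zero_of_lt_one (by linarith) (by linarith)).comp
      (Nat.tendsto_div_const_atTop hm.ne')
  rw [tendsto_iff_dist_tendsto_zero]
  exact squeeze_zero (fun _ => dist_nonneg) hbound hlim

/-- If all chains started at single states converge to `π`, then so do all chains. -/
theorem isLimitingDistribution_of_tendsto_pure {π : PMF α}
    (h : ∀ x y, Tendsto (fun n => (law K (PMF.pure x) n y).toReal) atTop (nhds (π y).toReal)) :
    IsLimitingDistribution K π := by
  intro μ y
  rw [← ENNReal.tendsto_toReal_iff (fun _ => PMF.apply_ne_top _ _) (PMF.apply_ne_top _ _)]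
  have hsum : Summable fun x => (μ x).toReal := ENNReal.summable_toReal μ.tsum_coe_ne_top
  have hle : ∀ n x, (law K (PMF.pure x) n y).toReal ≤ 1 := fun n x =>
    ENNReal.toReal_le_of_le_ofReal zero_le_one (by simpa using PMF.coe_le_one _ _)
  -- The state space may be infinite; `μ` itself dominates the summands.
  have key := tendsto_tsum_of_dominated_convergence (𝓕 := atTop) hsum
    (f := fun n x => (μ x).toReal * (law K (PMF.pure x) n y).toReal)
    (fun x => (h x y).const_mul (μ x).toReal)
    (Eventually.of_forall fun n x => by
      rw [Real.norm_of_nonneg (mul_nonneg ENNReal.toReal_nonneg ENNReal.toReal_nonneg)]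
      exact mul_le_of_le_one_right ENNReal.toReal_nonneg (hle n x))
  have hone : ∑' x, (μ x).toReal = 1 := by
    rw [← ENNReal.tsum_toReal_eq fun x => μ.apply_ne_top x, μ.tsum_coe]
    rfl
  rw [tsum_mul_right, hone, one_mul] at key
  refine key.congr fun n => ?_
  rw [law_eq_bind, PMF.bind_apply, ENNReal.tsum_toReal_eq fun x =>
    ENNReal.mul_ne_top (μ.apply_ne_top x) (PMF.apply_ne_top _ _)]
  simp

/-- Convergence to a stationary law `π` for a chain whose states all lie in finite closed sets. -/
theorem isLimitingDistribution_of_unique {π : PMF α} (hπ : π.bind K = π)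
    (hfin : ∀ x, ∃ F : Set α, F.Finite ∧ x ∈ F ∧ ∀ x ∈ F, (K x).support ⊆ F)
    (hπfin : π.support.Finite) (hclosed : ∀ x ∈ π.support, (K x).support ⊆ π.support)
    (hloop : ∀ x ∈ π.support, x ∈ (K x).support) (huniq : ∃! C, IsClosedClass K C) :
    IsLimitingDistribution K π := by
  obtain ⟨C, -, hC⟩ := huniq
  obtain ⟨z, hz⟩ := π.support_nonempty
  obtain ⟨C', hC', hsub, -⟩ := exists_isClosedClass hπfin hclosed hz
  obtain ⟨y₀, hy₀⟩ := hC'.1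
  have hreach : ∀ x, LeadsTo K x y₀ := by
    intro x
    obtain ⟨F, hF, hx, hFc⟩ := hfin x
    obtain ⟨D, hD, -, hDx⟩ := exists_isClosedClass hF hFc hx
    exact hDx y₀ (by rw [hC D hD, ← hC C' hC']; exact hy₀)
  refine isLimitingDistribution_of_tendsto_pure fun x y => ?_
  obtain ⟨F, hF, hx, hFc⟩ := hfin x
  -- The finite closed set has to contain both the starting state and the support of `π`.
  have hfin' : (F ∪ π.support).Finite := hF.union hπfin
  refine tendsto_law_pure (F := hfin'.toFinset) (y₀ := y₀) ?_ ?_ (hloop _ (hsub hy₀))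
    (fun x _ => hreach x) hπ ?_ ?_ y
  · intro z hz
    rw [Set.Finite.coe_toFinset]
    rcases hfin'.mem_toFinset.1 hz with h | h
    · exact (hFc z h).trans Set.subset_union_left
    · exact (hclosed z h).trans Set.subset_union_right
  · exact hfin'.mem_toFinset.2 (Or.inr (hsub hy₀))
  · simp
  · exact hfin'.mem_toFinset.2 (Or.inl hx)

end MarkovChain

/-! ### Uniform laws and resampling within fibres. -/

namespace PMF

variable {α β : Type*}

theorem eq_of_support_subset_of_const {p : PMF α} {s : Finset α} (hs : s.Nonempty)
    (hp : ∀ x, x ∉ s → p x = 0) (hc : ∀ x ∈ s, ∀ y ∈ s, p x = p y) :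
    p = uniformOfFinset s hs := by
  have hsum : ∑ x ∈ s, p x = 1 := by
    rw [← p.tsum_coe]
    exact (tsum_eq_sum fun x hx => hp x hx).symm
  ext x
  by_cases hx : x ∈ s
  · rw [uniformOfFinset_apply_of_mem hs hx]
    rw [Finset.sum_congr rfl fun y hy => hc y hy x hx, Finset.sum_const, nsmul_eq_mul,
      mul_comm] at hsum
    exact ENNReal.eq_inv_of_mul_eq_one_left hsum
  · rw [uniformOfFinset_apply_of_notMem hs hx, hp x hx]

theorem map_apply_of_injective (p : PMF α) {f : α → β} (hf : Function.Injective f) (x : α) :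
    p.map f (f x) = p x := by
  classical
  rw [map_apply, tsum_eq_single x]
  · simp
  · intro y hy
    rw [if_neg fun h => hy (hf h.symm)]

theorem map_injective {f : α → β} (hf : Function.Injective f) :
    Function.Injective fun p : PMF α => p.map f := by
  intro p q h
  ext x
  rw [← map_apply_of_injective p hf, ← map_apply_of_injective q hf]
  exact congrArg (fun r : PMF β => r (f x)) h

theorem uniformOfFinset_map {s : Finset α} (hs : s.Nonempty) (f : α ↪ β) :
    (uniformOfFinset s hs).map f = uniformOfFinset (s.map f) (hs.map) := by
  apply eq_of_support_subset_of_const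
  · intro y hy
    rw [apply_eq_zero_iff, support_map, support_uniformOfFinset]
    simpa using hy
  · intro x hx y hy
    obtain ⟨a, ha, rfl⟩ := Finset.mem_map.1 hx
    obtain ⟨b, hb, rfl⟩ := Finset.mem_map.1 hy
    rw [map_apply_of_injective _ f.injective, map_apply_of_injective _ f.injective,
      uniformOfFinset_apply_of_mem hs ha, uniformOfFinset_apply_of_mem hs hb]

/-- The uniform law on `s` is invariant under resampling uniformly within the fibres of `f`. -/
theorem uniformOfFinset_bind_fiber {s : Finset α} (hs : s.Nonempty) (f : α → β) (g : α → PMF α)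
    (t : α → Finset α) (ht : ∀ x ∈ s, ∀ y, y ∈ t x ↔ y ∈ s ∧ f y = f x)
    (hg : ∀ x ∈ s, ∃ h : (t x).Nonempty, g x = uniformOfFinset (t x) h) :
    (uniformOfFinset s hs).bind g = uniformOfFinset s hs := by
  classical
  have hgxy : ∀ x ∈ s, ∀ y, g x y = if y ∈ t x then ((t x).card : ENNReal)⁻¹ else 0 := by
    intro x hx y
    obtain ⟨h, hgx⟩ := hg x hx
    rw [hgx, uniformOfFinset_apply]
  have hbind : ∀ y, (uniformOfFinset s hs).bind g y = (s.card : ENNReal)⁻¹ * ∑ x ∈ s, g x y := by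
    intro y
    rw [bind_apply, tsum_eq_sum (s := s), Finset.mul_sum]
    · exact Finset.sum_congr rfl fun x hx => by rw [uniformOfFinset_apply_of_mem hs hx]
    · intro x hx
      rw [uniformOfFinset_apply_of_notMem hs hx, zero_mul]
  ext y
  rw [hbind]
  by_cases hy : y ∈ s
  · rw [uniformOfFinset_apply_of_mem hs hy]
    have hty : t y ⊆ s := fun x hx => ((ht y hy x).1 hx).1
    have heq : ∀ x ∈ t y, t x = t y := by
      intro x hx
      ext z
      rw [ht x (hty hx), ht y hy, ((ht y hy x).1 hx).2]
    -- Only the states in the fibre of `y` send mass to `y`, each the reciprocal of the size of that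
    -- fibre.
    have hsum : ∑ x ∈ s, g x y = 1 := by
      rw [← Finset.sum_subset hty]
      · have : ∀ x ∈ t y, g x y = ((t y).card : ENNReal)⁻¹ := by
          intro x hx
          rw [hgxy x (hty hx), heq x hx, if_pos ((ht y hy y).2 ⟨hy, rfl⟩)]
        rw [Finset.sum_congr rfl this, Finset.sum_const, nsmul_eq_mul]
        exact ENNReal.mul_inv_cancel
          (by simpa using Finset.ne_empty_of_mem ((ht y hy y).2 ⟨hy, rfl⟩)) (by simp)
      · intro x hx hxt
        rw [hgxy x hx, if_neg]
        intro hyx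
        exact hxt ((ht y hy x).2 ⟨hx, ((ht x hx y).1 hyx).2.symm⟩)
    rw [hsum, mul_one]
  · rw [uniformOfFinset_apply_of_notMem hs hy, Finset.sum_eq_zero, mul_zero]
    intro x hx
    rw [hgxy x hx, if_neg fun h => hy ((ht x hx y).1 h).1]

theorem bind_congr_of_support {p : PMF α} {f g : α → PMF β} (h : ∀ x ∈ p.support, f x = g x) :
    p.bind f = p.bind g := by
  ext y
  simp only [bind_apply]
  refine tsum_congr fun x => ?_
  by_cases hx : p x = 0
  · simp [hx]
  · rw [h x ((p.mem_support_iff x).2 hx)]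

end PMF

/-! ### Cutting and splicing walks and shortest paths. -/

namespace ChainPursuit

section Walks

variable {V : Type*} {G : SimpleGraph V} {s t u v w : V}

theorem IsWalk.take {P : List V} (hP : IsWalk G s t P) (j : ℕ) :
    IsWalk G s (P.getD j t) (P.take (j + 1)) := by
  obtain ⟨h1, h2, h3⟩ := hP
  refine ⟨h1.take _, by simpa [List.head?_take] using h2, ?_⟩
  rw [List.getLast?_take]
  by_cases hj : j < P.length
  · simp [hj]
  · simp [List.getElem?_eq_none (not_lt.1 hj), h3]

/-- Replacing the part of a walk up to index `j` by another walk to the same vertex. -/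
theorem IsWalk.append_drop {P r : List V} {j : ℕ} (hP : IsWalk G s t P)
    (hr : IsWalk G v (P.getD j t) r) : IsWalk G v t (r ++ P.drop (j + 1)) := by
  by_cases hj : j + 1 < P.length
  · obtain ⟨h1, h2, h3⟩ := hr
    refine ⟨List.isChain_append.2 ⟨h1, hP.1.drop _, ?_⟩, by simp [List.head?_append, h2], ?_⟩
    · intro x hx y hy
      rw [h3] at hx
      rw [List.head?_drop, List.getElem?_eq_getElem hj] at hy
      simp only [Option.mem_def, Option.some.injEq] at hx hy
      subst hx hy
      have := hP.getD_step j
      rwa [List.getD_eq_getElem _ _ hj] at this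
    · rw [List.getLast?_append, List.getLast?_drop, if_neg (by omega), hP.2.2]
      rfl
  · rw [List.drop_eq_nil_of_le (by omega), List.append_nil]
    rwa [hP.getD_of_le (by omega)] at hr

theorem IsWalk.getD_length_sub_one {P : List V} (hP : IsWalk G s t P) (x : V) :
    P.getD (P.length - 1) x = t := by
  rw [List.getD_eq_getElem?_getD, ← List.getLast?_eq_getElem?, hP.2.2]
  rfl

theorem IsWalk.eq_cons {P : List V} (hP : IsWalk G s t P) : ∃ q, P = s :: q := by
  obtain ⟨-, h2, -⟩ := hP
  cases P with
  | nil => simp at h2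
  | cons a q => exact ⟨q, by simpa using h2⟩

theorem IsWalk.eq_cons_cons {P : List V} (hP : IsWalk G s t P) (hl : 2 ≤ P.length) :
    ∃ w q, P = s :: w :: q ∧ (s = w ∨ G.Adj s w) ∧ IsWalk G w t (w :: q) := by
  obtain ⟨q, rfl⟩ := hP.eq_cons
  obtain ⟨h1, h2, h3⟩ := hP
  cases q with
  | nil => simp at hl
  | cons w q =>
    rw [List.isChain_cons_cons] at h1
    exact ⟨w, q, rfl, h1.1, h1.2, rfl, by simpa [List.getLast?_cons_cons] using h3⟩

end Walks

section Geodesics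

variable {V : Type*} [Finite V] {G : SimpleGraph V} {s t u v w : V}

/-- The shortest paths from `s` to `t`, as lists of vertices. -/
noncomputable def geodesics (G : SimpleGraph V) (s t : V) : Finset (List V) :=
  (shortestPaths G s t).map (Function.Embedding.subtype _)

theorem mem_geodesics {l : List V} : l ∈ geodesics G s t ↔
    IsWalk G s t l ∧ ∀ l', IsWalk G s t l' → l.length ≤ l'.length := by
  simp only [geodesics, Finset.mem_map, mem_shortestPaths, Function.Embedding.subtype_apply]
  constructor
  · rintro ⟨p, hp, rfl⟩
    exact ⟨p.2, fun l' hl' => hp ⟨l', hl'⟩⟩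
  · rintro ⟨h, hmin⟩
    exact ⟨⟨l, h⟩, fun q => hmin q.1 q.2, rfl⟩

theorem mem_geodesics_of_length_le {l l' : List V} (hl : l ∈ geodesics G s t)
    (hw : IsWalk G s t l') (h : l'.length ≤ l.length) : l' ∈ geodesics G s t :=
  mem_geodesics.2 ⟨hw, fun p hp => h.trans ((mem_geodesics.1 hl).2 p hp)⟩

theorem length_eq_of_mem_geodesics {l l' : List V} (hl : l ∈ geodesics G s t)
    (hl' : l' ∈ geodesics G s t) : l.length = l'.length :=
  le_antisymm ((mem_geodesics.1 hl).2 _ (mem_geodesics.1 hl').1)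
    ((mem_geodesics.1 hl').2 _ (mem_geodesics.1 hl).1)

/-- A shorter walk to the vertex at index `j` could be spliced into `P` and would shorten it. Beyond
the end of `P` the default `t` makes the prefix all of `P`. -/
theorem take_mem_geodesics {P : List V} (hP : P ∈ geodesics G s t) (j : ℕ) :
    P.take (j + 1) ∈ geodesics G s (P.getD j t) := by
  obtain ⟨hw, hmin⟩ := mem_geodesics.1 hP
  refine mem_geodesics.2 ⟨hw.take j, fun r hr => ?_⟩
  have := hmin _ (hw.append_drop hr)
  simp only [List.length_append, List.length_drop, List.length_take] at this ⊢
  omega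

theorem append_drop_mem_geodesics {P r : List V} {j : ℕ} (hP : P ∈ geodesics G s t)
    (hr : r ∈ geodesics G s (P.getD j t)) : r ++ P.drop (j + 1) ∈ geodesics G s t := by
  refine mem_geodesics_of_length_le hP
    ((mem_geodesics.1 hP).1.append_drop (mem_geodesics.1 hr).1) ?_
  have := length_eq_of_mem_geodesics hr (take_mem_geodesics hP j)
  simp only [List.length_append, List.length_drop, List.length_take] at this ⊢
  omega

theorem length_of_mem_geodesics_getD {P r : List V} {j : ℕ} (hP : P ∈ geodesics G s t)
    (hr : r ∈ geodesics G s (P.getD j t)) : r.length = min (j + 1) P.length := by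
  rw [length_eq_of_mem_geodesics hr (take_mem_geodesics hP j), List.length_take]

/-- Together with `getD_append_drop`, this shows that splicing preserves the vertex at `j` and
everything after it, the data whose fibres are resampled in `geodesicLaw_bind_resample`. -/
theorem drop_append_drop {P r : List V} {j : ℕ} (hP : P ∈ geodesics G s t)
    (hr : r ∈ geodesics G s (P.getD j t)) : (r ++ P.drop (j + 1)).drop (j + 1) = P.drop (j + 1) := by
  have := length_of_mem_geodesics_getD hP hr
  by_cases hj : j + 1 ≤ P.length
  · exact List.drop_left' (by omega)
  · rw [List.drop_eq_nil_of_le (as := P) (by omega), List.drop_eq_nil_of_le]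
    simp
    omega

theorem getD_append_drop {P r : List V} {j : ℕ} (hP : P ∈ geodesics G s t)
    (hr : r ∈ geodesics G s (P.getD j t)) : (r ++ P.drop (j + 1)).getD j t = P.getD j t := by
  have := length_of_mem_geodesics_getD hP hr
  by_cases hj : j + 1 ≤ P.length
  · have h := (mem_geodesics.1 hr).1.getD_length_sub_one t
    rw [show r.length - 1 = j by omega] at h
    rwa [List.getD_append _ _ _ _ (by omega)]
  · rw [List.getD_eq_default _ _ (by simp; omega), List.getD_eq_default _ _ (by omega)]

/-- One shortest path through `w` shows that `w` is one step closer to `t` than `v`, so prepending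
`v` to any shortest path from `w` gives a shortest path. This identifies the fibres of the first
step. -/
theorem cons_mem_geodesics_iff {q : List V} (h : v :: w :: q ∈ geodesics G v t) {l : List V} :
    l ∈ (geodesics G w t).map ⟨List.cons v, List.cons_injective⟩ ↔
      l ∈ geodesics G v t ∧ l.getD 1 v = w := by
  obtain ⟨hw, hmin⟩ := mem_geodesics.1 h
  obtain ⟨_, _, heq, hadj, hwalk⟩ := hw.eq_cons_cons (by simp)
  obtain ⟨rfl, rfl⟩ : w = _ ∧ q = _ := by simpa using heq
  simp only [Finset.mem_map, Function.Embedding.coeFn_mk]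
  constructor
  · rintro ⟨r, hr, rfl⟩
    obtain ⟨hr1, hr2⟩ := mem_geodesics.1 hr
    obtain ⟨q', rfl⟩ := hr1.eq_cons
    refine ⟨mem_geodesics_of_length_le h (hr1.cons hadj) ?_, rfl⟩
    simpa using hr2 _ hwalk
  · rintro ⟨hl, hlw⟩
    obtain ⟨hl1, hl2⟩ := mem_geodesics.1 hl
    have hlen := length_eq_of_mem_geodesics hl h
    obtain ⟨w', q', rfl, -, hwalk'⟩ := hl1.eq_cons_cons (by simp [hlen])
    obtain rfl : w' = w := by simpa using hlw
    refine ⟨_, mem_geodesics.2 ⟨hwalk', fun p hp => ?_⟩, rfl⟩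
    simpa using hl2 _ (hp.cons hadj)

theorem tail_mem_geodesics {q : List V} (h : v :: w :: q ∈ geodesics G v t) :
    w :: q ∈ geodesics G w t := by
  obtain ⟨r, hr, heq⟩ := Finset.mem_map.1 ((cons_mem_geodesics_iff h).2 ⟨h, rfl⟩)
  obtain rfl : r = w :: q := by simpa using heq
  exact hr

open Classical in
/-- The uniform law on the shortest paths from `s` to `t`, as lists of vertices. -/
noncomputable def geodesicLaw (G : SimpleGraph V) (s t : V) : PMF (List V) :=
  if h : (geodesics G s t).Nonempty then PMF.uniformOfFinset _ h else PMF.pure [s]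

theorem geodesicLaw_of_nonempty (h : (geodesics G s t).Nonempty) :
    geodesicLaw G s t = PMF.uniformOfFinset _ h := dif_pos h

theorem mem_support_geodesicLaw (h : (geodesics G s t).Nonempty) {l : List V} :
    l ∈ (geodesicLaw G s t).support ↔ l ∈ geodesics G s t := by
  rw [geodesicLaw_of_nonempty h, PMF.mem_support_uniformOfFinset_iff]

theorem uniformOfFinset_shortestPaths_map (h : (shortestPaths G s t).Nonempty) :
    (PMF.uniformOfFinset _ h).map Subtype.val = geodesicLaw G s t := by
  rw [geodesicLaw_of_nonempty (by simpa [geodesics] using h)]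
  exact PMF.uniformOfFinset_map h (Function.Embedding.subtype _)

theorem nextVertex_eq_map (v u : V) :
    nextVertex G v u = (geodesicLaw G v u).map fun p => p.getD 1 v := by
  rw [nextVertex]
  split_ifs with h
  · rw [← uniformOfFinset_shortestPaths_map (shortestPaths_nonempty h), PMF.map_comp]
    rfl
  -- The junk value `[v]` has no entry at index 1, so the default `v` is returned, in agreement with
  -- `nextVertex`.
  · rw [geodesicLaw, dif_neg]
    · simp [PMF.pure_map]
    · rintro ⟨l, hl⟩
      exact h ⟨⟨l, (mem_geodesics.1 hl).1⟩⟩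

/-- Resampling uniformly the part of a shortest path up to index `j` preserves the uniform law. -/
theorem geodesicLaw_bind_resample (h : (geodesics G s t).Nonempty) (j : ℕ) :
    ((geodesicLaw G s t).bind fun P =>
      (geodesicLaw G s (P.getD j t)).map fun r => r ++ P.drop (j + 1)) = geodesicLaw G s t := by
  rw [geodesicLaw_of_nonempty h]
  refine PMF.uniformOfFinset_bind_fiber h (fun P => (P.getD j t, P.drop (j + 1))) _
    (fun P => (geodesics G s (P.getD j t)).map
      ⟨fun r => r ++ P.drop (j + 1), List.append_left_injective _⟩) ?_ ?_
  · intro P hP R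
    simp only [Finset.mem_map, Function.Embedding.coeFn_mk, Prod.mk.injEq]
    constructor
    · rintro ⟨r, hr, rfl⟩
      exact ⟨append_drop_mem_geodesics hP hr, getD_append_drop hP hr, drop_append_drop hP hr⟩
    · rintro ⟨hR, h1, h2⟩
      exact ⟨R.take (j + 1), by rw [← h1]; exact take_mem_geodesics hR j,
        by rw [← h2, List.take_append_drop]⟩
  · intro P hP
    have hne : (geodesics G s (P.getD j t)).Nonempty := ⟨_, take_mem_geodesics hP j⟩
    refine ⟨hne.map, ?_⟩
    rw [geodesicLaw_of_nonempty hne, ← PMF.uniformOfFinset_map]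
    rfl

/-- Resampling a shortest path after its first step preserves the uniform law. -/
theorem geodesicLaw_bind_cons (h : (geodesics G v t).Nonempty)
    (hlen : ∀ l ∈ geodesics G v t, 2 ≤ l.length) :
    ((geodesicLaw G v t).bind fun R => (geodesicLaw G (R.getD 1 v) t).map (List.cons v)) =
      geodesicLaw G v t := by
  rw [geodesicLaw_of_nonempty h]
  refine PMF.uniformOfFinset_bind_fiber h (fun R => R.getD 1 v) _
    (fun R => (geodesics G (R.getD 1 v) t).map ⟨List.cons v, List.cons_injective⟩) ?_ ?_
  · intro R hR l
    obtain ⟨w, q, rfl, -⟩ := (mem_geodesics.1 hR).1.eq_cons_cons (hlen R hR)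
    exact cons_mem_geodesics_iff hR
  · intro R hR
    obtain ⟨w, q, rfl, -⟩ := (mem_geodesics.1 hR).1.eq_cons_cons (hlen R hR)
    have hne : (geodesics G w t).Nonempty := ⟨_, tail_mem_geodesics hR⟩
    refine ⟨hne.map, ?_⟩
    exact (congrArg (PMF.map (List.cons v)) (geodesicLaw_of_nonempty hne)).trans
      (PMF.uniformOfFinset_map hne ⟨List.cons v, List.cons_injective⟩)

end Geodesics

/-! ### Pursuit of a uniformly random shortest path. -/

section Pursuit

variable {V : Type*} [Finite V] {G : SimpleGraph V} {Δ : ℕ} {s t u v w : V}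

/-- From time `k` on, the pursuer uses only the entries of `P` from index `k + Δ` and the time left
until `P` ends. This permits shifting the clock and changing the earlier part of the path. -/
theorem pursue_congr {P P' : List V} (N : ℕ) : ∀ (k k' : ℕ) (v : V),
    P.length + k' = P'.length + k → (∀ j, P.getD (k + Δ + j) t = P'.getD (k' + Δ + j) t) →
    pursue G Δ t P N k v = pursue G Δ t P' N k' v := by
  induction N with
  | zero => intros; rfl
  | succ N ih =>
    intro k k' v hlen hget
    have h0 := hget 0
    simp only [add_zero] at h0
    have hiff : (P.length ≤ k + Δ + 1 ∧ v = t) ↔ (P'.length ≤ k' + Δ + 1 ∧ v = t) :=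
      and_congr_left fun _ => by omega
    have hrec : ∀ w, pursue G Δ t P N (k + 1) w = pursue G Δ t P' N (k' + 1) w := fun w =>
      ih (k + 1) (k' + 1) w (by omega) fun j => by
        have := hget (1 + j)
        rwa [show k + Δ + (1 + j) = k + 1 + Δ + j by omega,
          show k' + Δ + (1 + j) = k' + 1 + Δ + j by omega] at this
    simp only [pursue, h0, hrec]
    by_cases h : P.length ≤ k + Δ + 1 ∧ v = t
    · rw [if_pos h, if_pos (hiff.1 h)]
    · rw [if_neg h, if_neg (mt hiff.2 h)]

/-- The pursuit of a shortest path resamples its part up to index `Δ`, makes the first step of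
the result, and goes on with the pursuit of the rest. -/
theorem pursue_eq_resample (hΔ : 0 < Δ) {P : List V} (hP : P ∈ geodesics G v t) (hlen : 2 ≤ P.length) :
    pursue G Δ t P P.length 0 v =
      ((geodesicLaw G v (P.getD Δ t)).map fun r => r ++ P.drop (Δ + 1)).bind fun R =>
        (pursue G Δ t R.tail R.tail.length 0 (R.getD 1 v)).map (List.cons v) := by
  obtain ⟨w, q, rfl, -⟩ := (mem_geodesics.1 hP).1.eq_cons_cons hlen
  have hvt : v ≠ t := by
    rintro rfl
    simpa using (mem_geodesics.1 hP).2 _ (isWalk_singleton G v)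
  rw [show (v :: w :: q).length = (w :: q).length + 1 from rfl, pursue, if_neg fun h => hvt h.2,
    zero_add, nextVertex_eq_map, PMF.bind_map, PMF.bind_map]
  refine PMF.bind_congr_of_support fun r hr => ?_
  rw [mem_support_geodesicLaw ⟨_, take_mem_geodesics hP Δ⟩] at hr
  have hrlen := length_of_mem_geodesics_getD hP hr
  have hget := drop_append_drop hP hr
  have hRlen := length_eq_of_mem_geodesics (append_drop_mem_geodesics hP hr) hP
  -- The spliced-in path has `min (Δ + 1) P.length` vertices, hence at least two because `Δ` is
  -- positive; its second vertex is therefore also that of `R`.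
  obtain ⟨w', q', rfl, -⟩ := (mem_geodesics.1 hr).1.eq_cons_cons (by simp [hrlen]; omega)
  simp only [Function.comp_apply]
  refine congrArg _ ?_
  simp only [List.cons_append, List.tail_cons, List.length_cons] at hRlen ⊢
  rw [show q.length + 1 = (q' ++ List.drop (Δ + 1) (v :: w :: q)).length + 1 by omega]
  -- Pursuing `P` from time 1 and `R.tail` from time 0 is the same, as only the common part after
  -- index `Δ` is seen.
  refine pursue_congr _ _ _ _ (by simp only [List.length_cons]; omega) fun j => ?_
  have := congrArg (fun l => l.getD j t) hget
  simp only [List.getD_eq_getElem?_getD, List.getElem?_drop] at this ⊢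
  rw [show 1 + Δ + j = Δ + 1 + j by omega, ← this, show Δ + 1 + j = 0 + Δ + j + 1 by omega]
  rfl

theorem geodesicLaw_bind_pursue (hΔ : 0 < Δ) (n : ℕ) : ∀ v : V, (geodesics G v t).Nonempty →
    (∀ l ∈ geodesics G v t, l.length = n + 1) →
    ((geodesicLaw G v t).bind fun P => pursue G Δ t P P.length 0 v) = geodesicLaw G v t := by
  induction n with
  | zero =>
    intro v h hlen
    refine (PMF.bind_congr_of_support fun P hP => ?_).trans (PMF.bind_pure _)
    rw [mem_support_geodesicLaw h] at hP
    obtain ⟨h1, h2, h3⟩ := (mem_geodesics.1 hP).1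
    obtain ⟨a, rfl⟩ := List.length_eq_one_iff.1 (hlen P hP)
    obtain rfl : a = v := by simpa using h2
    obtain rfl : a = t := by simpa using h3
    simp [pursue]
  | succ n ih =>
    intro v h hlen
    have hlen2 : ∀ l ∈ geodesics G v t, 2 ≤ l.length := fun l hl => by rw [hlen l hl]; omega
    let step : List V → PMF (List V) := fun R =>
      (pursue G Δ t R.tail R.tail.length 0 (R.getD 1 v)).map (List.cons v)
    have hpursue : ((geodesicLaw G v t).bind fun P => pursue G Δ t P P.length 0 v) =
        (geodesicLaw G v t).bind step := by
      -- The spliced path `R` has the same law as `P`, so the resampling inside `pursue_eq_resample`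
      -- is absorbed.
      conv_rhs => rw [← geodesicLaw_bind_resample h Δ, PMF.bind_bind]
      refine PMF.bind_congr_of_support fun P hP => ?_
      rw [mem_support_geodesicLaw h] at hP
      exact pursue_eq_resample hΔ hP (hlen2 P hP)
    rw [hpursue]
    -- Both sides are split into the first step and a uniform shortest path from there, to which the
    -- induction hypothesis applies.
    conv_lhs => rw [← geodesicLaw_bind_cons h hlen2, PMF.bind_bind]
    conv_rhs => rw [← geodesicLaw_bind_cons h hlen2]
    refine PMF.bind_congr_of_support fun R hR => ?_
    rw [mem_support_geodesicLaw h] at hR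
    obtain ⟨w, q, rfl, -⟩ := (mem_geodesics.1 hR).1.eq_cons_cons (hlen2 R hR)
    have htail := tail_mem_geodesics hR
    have hne : (geodesics G w t).Nonempty := ⟨_, htail⟩
    change ((geodesicLaw G w t).map (List.cons v)).bind step = (geodesicLaw G w t).map (List.cons v)
    conv_rhs => rw [← ih w hne fun l hl => by
      rw [length_eq_of_mem_geodesics hl htail]; simpa using hlen _ hR, PMF.map_bind]
    rw [PMF.bind_map]
    refine PMF.bind_congr_of_support fun R' hR' => ?_
    rw [mem_support_geodesicLaw hne] at hR'
    obtain ⟨q', rfl⟩ := (mem_geodesics.1 hR').1.eq_cons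
    rfl

/-- Each resampling may return the part it replaces, so the pursuer can copy its predecessor. This
gives the loops needed for aperiodicity. -/
theorem mem_support_pursue_self (hΔ : 0 < Δ) (n : ℕ) : ∀ (v : V) (P : List V), P ∈ geodesics G v t →
    P.length = n + 1 → P ∈ (pursue G Δ t P P.length 0 v).support := by
  induction n with
  | zero =>
    intro v P hP hlen
    obtain ⟨h1, h2, h3⟩ := (mem_geodesics.1 hP).1
    obtain ⟨a, rfl⟩ := List.length_eq_one_iff.1 hlen
    obtain rfl : a = v := by simpa using h2
    obtain rfl : a = t := by simpa using h3
    simp [pursue]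
  | succ n ih =>
    intro v P hP hlen
    rw [pursue_eq_resample hΔ hP (by omega), PMF.mem_support_bind_iff]
    refine ⟨P, ?_, ?_⟩
    · have htake := take_mem_geodesics hP Δ
      rw [PMF.support_map]
      exact ⟨P.take (Δ + 1), (mem_support_geodesicLaw ⟨_, htake⟩).2 htake,
        List.take_append_drop _ _⟩
    · obtain ⟨w, q, rfl, -⟩ := (mem_geodesics.1 hP).1.eq_cons_cons (by omega)
      rw [PMF.support_map]
      exact ⟨w :: q, ih w (w :: q) (tail_mem_geodesics hP) (by simpa using hlen), rfl⟩

end Pursuit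
end ChainPursuit

/-! ### The chain on walks: monotone length and stationarity. -/

namespace ChainPursuit

section Chain

variable {V : Type*} [Finite V] {G : SimpleGraph V} {Δ : ℕ} {s t : V}

/-- A budget of `N + 1` steps alone would allow `N + 2` vertices. The invariant on the distance to
the predecessor puts the pursuer at `t` when one step of budget is left, so the stopping rule saves
that vertex. -/
theorem length_le_of_mem_support_pursue_aux (hΔ : 0 < Δ) {P : List V} (hP : IsWalk G s t P)
    (N : ℕ) : ∀ (k : ℕ) (v : V), k + (N + 1) = P.length →
      (∃ l, IsWalk G v (P.getD (k + Δ) t) l ∧ l.length ≤ Δ + 1 ∧ l.length ≤ N + 1) →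
      ∀ Q ∈ (pursue G Δ t P (N + 1) k v).support, Q.length ≤ N + 1 := by
  induction N with
  | zero =>
    rintro k v hk ⟨l, hl, -, hlen⟩ Q hQ
    rw [hP.getD_of_le (by omega)] at hl
    obtain ⟨q, rfl⟩ := hl.eq_cons
    obtain rfl : q = [] := by simpa using hlen
    obtain rfl : v = t := by simpa using hl.2.2
    rw [pursue, if_pos ⟨by omega, rfl⟩] at hQ
    simp only [PMF.support_pure, Set.mem_singleton_iff] at hQ
    simp [hQ]
  | succ N ih =>
    rintro k v hk ⟨l, hl, hlΔ, hlen⟩ Q hQ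
    rw [pursue] at hQ
    split_ifs at hQ with harr
    · simp only [PMF.support_pure, Set.mem_singleton_iff] at hQ
      simp [hQ]
    · simp only [PMF.mem_support_bind_iff, PMF.support_map, Set.mem_image] at hQ
      obtain ⟨w, hw, Q', hQ', rfl⟩ := hQ
      obtain ⟨hvw, l', hl', hlen'⟩ := nextVertex_spec hl hw
      rw [List.length_cons, Nat.add_le_add_iff_right]
      refine ih (k + 1) w (by omega) ?_ Q' hQ'
      by_cases hend : P.length ≤ k + Δ + 1
      · rw [hP.getD_of_le (by omega)] at hl'
        rw [hP.getD_of_le (by omega)]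
        exact ⟨l', hl', by omega, by omega⟩
      -- The predecessor's move adds a vertex to `l'`. It is still under way, so `Δ ≤ N` and the
      -- bound `Δ + 1` suffices; if `l'` is a single vertex, this needs `Δ` positive.
      · have := hl'.snoc (hP.getD_step (k + Δ))
        rw [show k + Δ + 1 = k + 1 + Δ by omega] at this
        exact ⟨_, this, by simp; omega, by simp; omega⟩

theorem length_le_of_mem_support_pursue (hΔ : 0 < Δ) {P : List V} (hP : IsWalk G s t P)
    {Q : List V} (hQ : Q ∈ (pursue G Δ t P P.length 0 s).support) : Q.length ≤ P.length := by
  obtain ⟨q, rfl⟩ := hP.eq_cons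
  obtain ⟨l, hl, h1, h2⟩ := hP.exists_prefix (0 + Δ)
  exact length_le_of_mem_support_pursue_aux hΔ hP q.length 0 s (by simp)
    ⟨l, hl, by omega, by simpa using h2⟩ Q hQ

theorem pursuitChain_map_val (P : Walk G s t) :
    (pursuitChain G Δ s t P).map Subtype.val = pursue G Δ t P.1 P.len 0 s := by
  rw [pursuitChain, PMF.map, ← PMF.bindOnSupport_eq_bind, PMF.bindOnSupport_bindOnSupport]
  simp only [PMF.pure_bindOnSupport, Function.comp_apply]
  exact PMF.bindOnSupport_pure _

theorem mem_support_pursuitChain {P Q : Walk G s t} :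
    Q ∈ (pursuitChain G Δ s t P).support ↔ Q.1 ∈ (pursue G Δ t P.1 P.1.length 0 s).support := by
  change _ ↔ Q.1 ∈ (pursue G Δ t P.1 P.len 0 s).support
  rw [← pursuitChain_map_val, PMF.support_map]
  exact (Subtype.val_injective.mem_set_image).symm

theorem len_le_of_mem_support_pursuitChain (hΔ : 0 < Δ) {P Q : Walk G s t}
    (hQ : Q ∈ (pursuitChain G Δ s t P).support) : Q.len ≤ P.len :=
  length_le_of_mem_support_pursue hΔ P.2 (mem_support_pursuitChain.1 hQ)

/-- The uniform law on the shortest paths is stationary for chain pursuit. -/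
theorem uniformOfFinset_shortestPaths_bind_pursuitChain (hΔ : 0 < Δ)
    (h : (shortestPaths G s t).Nonempty) :
    (PMF.uniformOfFinset _ h).bind (pursuitChain G Δ s t) = PMF.uniformOfFinset _ h := by
  apply PMF.map_injective Subtype.val_injective
  have hne : (geodesics G s t).Nonempty := h.map
  obtain ⟨P, hP⟩ := hne
  obtain ⟨q, rfl⟩ := (mem_geodesics.1 hP).1.eq_cons
  change PMF.map _ _ = PMF.map _ _
  rw [uniformOfFinset_shortestPaths_map, PMF.map_bind]
  simp only [pursuitChain_map_val]
  refine Eq.trans ?_ (geodesicLaw_bind_pursue hΔ q.length s ⟨_, hP⟩ fun l hl =>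
    length_eq_of_mem_geodesics hl hP)
  rw [← uniformOfFinset_shortestPaths_map h, PMF.bind_map]
  rfl

theorem mem_support_pursuitChain_self (hΔ : 0 < Δ) {P : Walk G s t}
    (hP : P ∈ shortestPaths G s t) : P ∈ (pursuitChain G Δ s t P).support := by
  have hP' : P.1 ∈ geodesics G s t := Finset.mem_map_of_mem (Function.Embedding.subtype _) hP
  obtain ⟨q, hq⟩ := P.2.eq_cons
  exact mem_support_pursuitChain.2 (mem_support_pursue_self hΔ q.length s P.1 hP' (by simp [hq]))

theorem finite_setOf_len_le (L : ℕ) : {P : Walk G s t | P.len ≤ L}.Finite :=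
  (List.finite_length_le V L).preimage Subtype.val_injective.injOn

end Chain

end ChainPursuit

theorem mainTheorem12 {V : Type*} [Finite V] (G : SimpleGraph V)
    (hG : ChainPursuit.IsStable G) (Δ : ℕ) (hΔ : 1 < Δ) (s t : V) :
    ∃ h : (ChainPursuit.shortestPaths G s t).Nonempty,
      MarkovChain.IsLimitingDistribution (ChainPursuit.pursuitChain G Δ s t)
        (PMF.uniformOfFinset (ChainPursuit.shortestPaths G s t) h) := by
  have hpos : 0 < Δ := by omega
  have hstable := hG s t Δ hΔ
  -- Closed classes are nonempty, so stability itself provides a walk from `s` to `t`.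
  obtain ⟨P₀, -⟩ := hstable.exists.choose_spec.1
  have h := ChainPursuit.shortestPaths_nonempty ⟨P₀⟩
  refine ⟨h, MarkovChain.isLimitingDistribution_of_unique
    (ChainPursuit.uniformOfFinset_shortestPaths_bind_pursuitChain hpos h) (fun P => ?_) ?_ ?_ ?_
    hstable⟩
  · exact ⟨{Q | Q.len ≤ P.len}, ChainPursuit.finite_setOf_len_le _, le_refl P.len, fun Q hQ R hR =>
      (ChainPursuit.len_le_of_mem_support_pursuitChain hpos hR).trans hQ⟩
  · rw [PMF.support_uniformOfFinset]
    exact Finset.finite_toSet _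
  · intro P hP Q hQ
    rw [PMF.mem_support_uniformOfFinset_iff, ChainPursuit.mem_shortestPaths] at hP ⊢
    exact fun R => (ChainPursuit.len_le_of_mem_support_pursuitChain hpos hQ).trans (hP R)
  · intro P hP
    rw [PMF.mem_support_uniformOfFinset_iff] at hP
    exact ChainPursuit.mem_support_pursuitChain_self hpos hP
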